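/- For an $n\times n$ real matrix $X=[x_{ij}]$ let $X^{\pi}$ be its rotation by 180 degrees, whose $(i,j)$ entry is $x_{n+1-i,\,n+1-j}$; $X$ is centrosymmetric if $X^{\pi}=X$. Let $\Omega_n^{\pi}$ be the polytope of centrosymmetric doubly stochastic $n\times n$ matrices. For $K,L\subseteq\{1,\dots,n\}$ let $X[K,L]$ be the submatrix with rows in $K$ and columns in $L$ (in increasing order), and let $\overline K,\overline L$ denote complements. If $n=2m-1$ is odd and $|K|=|L|$, then $X[K,L]$ is a centro-submatrix of $X$ if $m\in K\cap L$ and both $K$ and $L$ are invariant under $i\mapsto n+1-i$; it is isolated if $X[K,\overline L]$ and $X[\overline K,L]$ are zero matrices. An $r\times r$ permutation matrix $P=[p_{ij}]$ is anti-centrosymmetric if $p_{ij}=1$ implies $p_{r+1-i,\,r+1-j}=0$. In that case $P+P^{\pi}$ is called cyclic if its bipartite multigraph (one vertex for each row and each column, and as many edges between row $i$ and column $j$ as the $(i,j)$ entry says) is a single cycle of length $2r$; that is, if its rows and columns can be permuted so that row $k$ has its two 1's in columns $k$ and $k+1$ (modulo $r$). **Theorem.** Let $n=2m-1\ge 3$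 be odd. The set of extreme points of $\Omega_n^{\pi}$ is the set of $n\times n$ matrices $A$ for which there is a permutation matrix $Q=[q_{ij}]$ such that $A=\frac12(Q+Q^{\pi})$ and one of the following holds: (a) $q_{mm}=1$ and $Q$ is centrosymmetric (thus $Q=Q^{\pi}$ and $A$ is a centrosymmetric permutation matrix); or (b) $q_{mm}=0$, and there are an odd integer $r$, an $r\times r$ anti-centrosymmetric permutation matrix $P$ such that $P+P^{\pi}$ is cyclic, and an isolated centro-submatrix $A[K,L]$ of $A$ with $|K|=|L|=r$ and $A[K,L]=\frac12(P+P^{\pi})$, such that the complementary submatrix $A[\overline K,\overline L]$ is a (possibly empty) centrosymmetric permutation matrix (thus $Q[\overline K,\overline L]=Q[\overline K,\overline L]^{\pi}$). -/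

import Mathlib

namespace Centrosym

/-- The `180`-degree rotation `X^π`, with `(i, j)` entry `x_{n+1-i, n+1-j}`. -/
def rot {n : ℕ} (X : Matrix (Fin n) (Fin n) ℝ) : Matrix (Fin n) (Fin n) ℝ :=
  Matrix.of fun i j => X i.rev j.rev

/-- `X` is centrosymmetric: `X^π = X`. -/
def IsCentrosymmetric {n : ℕ} (X : Matrix (Fin n) (Fin n) ℝ) : Prop :=
  rot X = X

/-- `X` is a permutation matrix. -/
def IsPermutationMatrix {n : ℕ} (X : Matrix (Fin n) (Fin n) ℝ) : Prop :=
  ∃ σ : Equiv.Perm (Fin n), X = σ.permMatrix ℝ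

/-- The polytope `Ω_n^π` of centrosymmetric doubly stochastic `n × n` matrices. -/
def Omega (n : ℕ) : Set (Matrix (Fin n) (Fin n) ℝ) :=
  {X | X ∈ doublyStochastic ℝ (Fin n) ∧ IsCentrosymmetric X}

/-- The central index of `{1, …, n}` for odd `n = 2 m - 1`: the index `m`, which is `m - 1 = n / 2`
in the numbering from `0` that `Fin n` uses. -/
def centre {n : ℕ} (hn : Odd n) : Fin n :=
  ⟨n / 2, Nat.div_lt_self hn.pos one_lt_two⟩

/-- The `r × r` submatrix `X[K, L]`, rows in `K` and columns in `L` in their natural order. -/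
def sub {n r : ℕ} (X : Matrix (Fin n) (Fin n) ℝ) (K L : Finset (Fin n))
    (hK : K.card = r) (hL : L.card = r) : Matrix (Fin r) (Fin r) ℝ :=
  X.submatrix (K.orderEmbOfFin hK) (L.orderEmbOfFin hL)

theorem card_compl_eq {n r : ℕ} {K : Finset (Fin n)} (hK : K.card = r) :
    Kᶜ.card = n - r := by
  rw [Finset.card_compl, Fintype.card_fin, hK]

/-- The complementary submatrix `X[Kᶜ, Lᶜ]`. -/
def complSub {n r : ℕ} (X : Matrix (Fin n) (Fin n) ℝ) (K L : Finset (Fin n))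
    (hK : K.card = r) (hL : L.card = r) : Matrix (Fin (n - r)) (Fin (n - r)) ℝ :=
  sub X Kᶜ Lᶜ (card_compl_eq hK) (card_compl_eq hL)

/-- The index sets `K`, `L` (of equal size) define a centro-submatrix: both contain the central
index and both are invariant under `i ↦ n + 1 - i`. -/
def IsCentroPair {n : ℕ} (hn : Odd n) (K L : Finset (Fin n)) : Prop :=
  centre hn ∈ K ∧ centre hn ∈ L ∧ K.image Fin.rev = K ∧ L.image Fin.rev = L

/-- `X[K, L]` is isolated: `X[K, Lᶜ]` and `X[Kᶜ, L]` are zero matrices. -/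
def IsIsolated {n : ℕ} (X : Matrix (Fin n) (Fin n) ℝ) (K L : Finset (Fin n)) : Prop :=
  (∀ i ∈ K, ∀ j ∉ L, X i j = 0) ∧ (∀ i ∉ K, ∀ j ∈ L, X i j = 0)

/-- `P` is an anti-centrosymmetric permutation matrix. -/
def IsAntiCentrosymmetricPerm {r : ℕ} (P : Matrix (Fin r) (Fin r) ℝ) : Prop :=
  IsPermutationMatrix P ∧ ∀ i j, P i j = 1 → P i.rev j.rev = 0

/-- `X` is cyclic: the bipartite multigraph of the `r × r` matrix `X` (one vertex for each row, one
for each column, `x_{ij}` edges joining row `i` to column `j`) is a cycle of length `2 r`. That is,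
all rows and all columns can be listed as `u_0, …, u_{r-1}` and `v_0, …, v_{r-1}` so that the edges,
with multiplicity, are those of the closed walk `v_0 u_0 v_1 u_1 v_2 … v_{r-1} u_{r-1} v_0`. -/
def IsCyclic {r : ℕ} (X : Matrix (Fin r) (Fin r) ℝ) : Prop :=
  ∃ u v : Equiv.Perm (Fin r), ∀ k l : Fin r,
    X (u k) (v l) = (if l = k then 1 else 0) + (if l = finRotate r k then 1 else 0)

/-- The matrix `½ (Q + Q^π)`. -/
noncomputable def symmetrize {n : ℕ} (Q : Matrix (Fin n) (Fin n) ℝ) : Matrix (Fin n) (Fin n) ℝ :=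
  (1 / 2 : ℝ) • (Q + rot Q)

/-- The first kind: `q_mm = 1` and `Q` is centrosymmetric. -/
def IsTypeA {n : ℕ} (hn : Odd n) (Q : Matrix (Fin n) (Fin n) ℝ) : Prop :=
  Q (centre hn) (centre hn) = 1 ∧ IsCentrosymmetric Q

/-- The second kind, for `A = ½ (Q + Q^π)` and with given witnesses `r`, `P`, `K`, `L`. -/
def IsTypeB {n r : ℕ} (hn : Odd n) (Q : Matrix (Fin n) (Fin n) ℝ) (P : Matrix (Fin r) (Fin r) ℝ)
    (K L : Finset (Fin n)) (hK : K.card = r) (hL : L.card = r) : Prop :=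
  Q (centre hn) (centre hn) = 0 ∧ Odd r ∧
    IsAntiCentrosymmetricPerm P ∧ IsCyclic (P + rot P) ∧
    IsCentroPair hn K L ∧ IsIsolated (symmetrize Q) K L ∧
    sub (symmetrize Q) K L hK hL = symmetrize P ∧
    IsPermutationMatrix (complSub (symmetrize Q) K L hK hL) ∧
    IsCentrosymmetric (complSub (symmetrize Q) K L hK hL)

end Centrosym

namespace Centrosym

open Finset Equiv

/-! ### Centrosymmetric doubly stochastic matrices and their extreme points -/

section Basic

variable {n : ℕ}

/-! The linear map X ↦ ½(X + X^π) carries the Birkhoff polytope onto Ω_n^π, so every extreme point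
is ½(Q + Q^π) for a permutation matrix Q. It remains to decide which Q give extreme points.

Necessity: the components of the multigraph of Q + Q^π are the cycles of `walk σ`. Rotation permutes
them and reverses `walk σ`. A component mapped to itself has a central row or a central column, and
by parity both lie in one component (`not_sameCycle_rev`, `odd_card_iff`). Any other component is
therefore disjoint from its mirror image. If it were longer than a double edge, shifting weight from
Q to Q^π on it and from Q^π to Q on the mirror would exhibit the matrix as a proper midpoint in
Ω_n^π. So Q and Q^π agree off the central component, which is either a double edge (a) or a cycle
(b).

Sufficiency: an extreme point is recognised by being the only point of Ω_n^π with support inside its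
own. On a cycle, differences with zero line sums form a line spanned by P - P^π. Rotation acts there
as -1, so no nonzero difference is centrosymmetric (`IsCyclic.eq_zero_of_isCentrosymmetric`). -/

@[simp] theorem permMatrix_apply (σ : Perm (Fin n)) (i j : Fin n) :
    σ.permMatrix ℝ i j = if σ i = j then 1 else 0 := by
  simp [Perm.permMatrix, PEquiv.toMatrix_apply, eq_comm]

@[simp] theorem rot_apply (X : Matrix (Fin n) (Fin n) ℝ) (i j : Fin n) :
    rot X i j = X i.rev j.rev := rfl

@[simp] theorem symmetrize_apply (X : Matrix (Fin n) (Fin n) ℝ) (i j : Fin n) :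
    symmetrize X i j = (X i j + X i.rev j.rev) / 2 := by
  simp [symmetrize]; ring

theorem IsCentrosymmetric.apply_rev {X : Matrix (Fin n) (Fin n) ℝ} (hX : IsCentrosymmetric X)
    (i j : Fin n) : X i.rev j.rev = X i j :=
  congrFun (congrFun hX i) j

theorem isCentrosymmetric_symmetrize (X : Matrix (Fin n) (Fin n) ℝ) :
    IsCentrosymmetric (symmetrize X) := by
  ext i j
  simp [add_comm]

theorem IsCentrosymmetric.symmetrize_eq {X : Matrix (Fin n) (Fin n) ℝ}
    (hX : IsCentrosymmetric X) : symmetrize X = X := by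
  ext i j
  simp [hX.apply_rev]

/-- The conjugate of a permutation by the reversal of `Fin n`. -/
def rotPerm (σ : Perm (Fin n)) : Perm (Fin n) := Fin.revPerm * σ * Fin.revPerm

@[simp] theorem rotPerm_apply (σ : Perm (Fin n)) (i : Fin n) :
    rotPerm σ i = (σ i.rev).rev := rfl

theorem rot_permMatrix (σ : Perm (Fin n)) :
    rot (σ.permMatrix ℝ) = (rotPerm σ).permMatrix ℝ := by
  ext i j
  simp only [rot_apply, permMatrix_apply, rotPerm_apply, Fin.rev_eq_iff]

theorem permMatrix_rev_rev (σ : Perm (Fin n)) (i j : Fin n) :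
    σ.permMatrix ℝ i.rev j.rev = (rotPerm σ).permMatrix ℝ i j :=
  congrFun (congrFun (rot_permMatrix σ) i) j

theorem rot_mem_doublyStochastic {X : Matrix (Fin n) (Fin n) ℝ}
    (hX : X ∈ doublyStochastic ℝ (Fin n)) : rot X ∈ doublyStochastic ℝ (Fin n) := by
  rw [mem_doublyStochastic_iff_sum] at hX ⊢
  refine ⟨fun i j => hX.1 _ _, fun i => ?_, fun j => ?_⟩
  · rw [← hX.2.1 i.rev]
    exact Equiv.sum_comp Fin.revPerm (fun j => X i.rev j)
  · rw [← hX.2.2 j.rev]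
    exact Equiv.sum_comp Fin.revPerm (fun i => X i j.rev)

theorem symmetrize_mem_Omega {X : Matrix (Fin n) (Fin n) ℝ}
    (hX : X ∈ doublyStochastic ℝ (Fin n)) : symmetrize X ∈ Omega n := by
  refine ⟨?_, isCentrosymmetric_symmetrize X⟩
  have := convex_doublyStochastic (R := ℝ) (n := Fin n) hX (rot_mem_doublyStochastic hX)
    (a := 1 / 2) (b := 1 / 2) (by norm_num) (by norm_num) (by norm_num)
  rwa [← smul_add] at this

/-- The map `X ↦ ½ (X + X^π)` as a linear map. -/
noncomputable def symmetrizeLinear (n : ℕ) :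
    Matrix (Fin n) (Fin n) ℝ →ₗ[ℝ] Matrix (Fin n) (Fin n) ℝ where
  toFun := symmetrize
  map_add' X Y := by ext i j; simp; ring
  map_smul' c X := by ext i j; simp; ring

/-- Birkhoff's theorem pushed through a linear map that fixes every centrosymmetric matrix. -/
theorem Omega_subset_convexHull :
    Omega n ⊆ convexHull ℝ (symmetrize '' {σ.permMatrix ℝ | σ : Perm (Fin n)}) := by
  rintro X ⟨hX, hXc⟩
  have h := (symmetrizeLinear n).image_convexHull {σ.permMatrix ℝ | σ : Perm (Fin n)}
  rw [← doublyStochastic_eq_convexHull_permMatrix] at h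
  change _ = convexHull ℝ (symmetrize '' _) at h
  rw [← h]
  exact ⟨X, hX, hXc.symmetrize_eq⟩

theorem exists_eq_symmetrize_of_mem_extremePoints {A : Matrix (Fin n) (Fin n) ℝ}
    (hA : A ∈ (Omega n).extremePoints ℝ) :
    ∃ σ : Perm (Fin n), A = symmetrize (σ.permMatrix ℝ) := by
  have hconv : Convex ℝ (Omega n) := by
    rintro X ⟨hX, hXc⟩ Y ⟨hY, hYc⟩ a b ha hb hab
    refine ⟨convex_doublyStochastic hX hY ha hb hab, ?_⟩
    ext i j
    simp [hXc.apply_rev, hYc.apply_rev]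
  have hO : Omega n = convexHull ℝ (symmetrize '' {σ.permMatrix ℝ | σ : Perm (Fin n)}) := by
    refine Omega_subset_convexHull.antisymm (convexHull_min ?_ hconv)
    rintro _ ⟨_, ⟨σ, rfl⟩, rfl⟩
    exact symmetrize_mem_Omega permMatrix_mem_doublyStochastic
  rw [hO] at hA
  obtain ⟨_, ⟨σ, rfl⟩, rfl⟩ := extremePoints_convexHull_subset hA
  exact ⟨σ, rfl⟩

/-- A point of `Ω_n^π` is extreme as soon as it is the only point of `Ω_n^π` whose support is
contained in its own. -/
theorem mem_extremePoints_Omega_of_unique_support {A : Matrix (Fin n) (Fin n) ℝ} (hA : A ∈ Omega n)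
    (h : ∀ B ∈ Omega n, (∀ i j, A i j = 0 → B i j = 0) → B = A) :
    A ∈ (Omega n).extremePoints ℝ := by
  rw [mem_extremePoints_iff_left]
  refine ⟨hA, fun B hB C hC hABC => h B hB fun i j hij => ?_⟩
  obtain ⟨a, b, ha, hb, -, rfl⟩ := hABC
  have h1 : 0 ≤ B i j := hB.1.1 i j
  have h2 : 0 ≤ C i j := hC.1.1 i j
  simp only [Matrix.add_apply, Matrix.smul_apply, smul_eq_mul] at hij
  nlinarith [mul_nonneg ha.le h1, mul_nonneg hb.le h2, mul_pos ha ha]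

theorem eq_zero_of_eq_one_of_ne {A : Matrix (Fin n) (Fin n) ℝ} (hA : A ∈ doublyStochastic ℝ (Fin n))
    {i j k : Fin n} (hij : A i j = 1) (hk : k ≠ j) : A i k = 0 := by
  have h := sum_row_of_mem_doublyStochastic hA i
  rw [← add_sum_erase _ _ (mem_univ j), hij, add_eq_left,
    sum_eq_zero_iff_of_nonneg (fun l _ => hA.1 i l)] at h
  exact h k (by simp [hk])

theorem eq_one_of_support_subset {A B : Matrix (Fin n) (Fin n) ℝ}
    (hA : A ∈ doublyStochastic ℝ (Fin n)) (hB : B ∈ doublyStochastic ℝ (Fin n))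
    {i j : Fin n} (hij : A i j = 1) (hsupp : ∀ k, A i k = 0 → B i k = 0) : B i j = 1 := by
  rw [← sum_row_of_mem_doublyStochastic hB i]
  refine (sum_eq_single_of_mem j (mem_univ j) fun k _ hk => hsupp k ?_).symm
  exact eq_zero_of_eq_one_of_ne hA hij hk

theorem isPermutationMatrix_mem_extremePoints {A : Matrix (Fin n) (Fin n) ℝ}
    (hA : IsPermutationMatrix A) (hc : IsCentrosymmetric A) : A ∈ (Omega n).extremePoints ℝ := by
  obtain ⟨σ, rfl⟩ := hA
  have hD : σ.permMatrix ℝ ∈ doublyStochastic ℝ (Fin n) := permMatrix_mem_doublyStochastic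
  refine mem_extremePoints_Omega_of_unique_support ⟨hD, hc⟩ fun B hB hsupp => ?_
  ext i j
  by_cases hij : σ i = j
  · rw [eq_one_of_support_subset hD hB.1 (j := j) (by simp [hij]) (hsupp i)]
    simp [hij]
  · rw [hsupp i j (by simp [hij])]
    simp [hij]

theorem rev_eq_self_iff (hn : Odd n) {i : Fin n} : i.rev = i ↔ i = centre hn := by
  obtain ⟨m, rfl⟩ := hn
  simp only [Fin.ext_iff, Fin.val_rev, centre]
  omega

@[simp] theorem rev_centre (hn : Odd n) : (centre hn).rev = centre hn :=
  (rev_eq_self_iff hn).2 rfl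

end Basic

/-! ### Submatrices on rotation-invariant index sets -/

section Sub

variable {n r : ℕ} {K L : Finset (Fin n)}

theorem rev_mem_iff (hK : K.image Fin.rev = K) {i : Fin n} : i.rev ∈ K ↔ i ∈ K := by
  have h : ∀ i ∈ K, i.rev ∈ K := fun i hi => by
    rw [← hK]; exact mem_image_of_mem _ hi
  exact ⟨fun hi => by simpa using h _ hi, h i⟩

theorem image_rev_compl (hK : K.image Fin.rev = K) : Kᶜ.image Fin.rev = Kᶜ := by
  ext i
  simp only [mem_image, mem_compl]
  constructor
  · rintro ⟨j, hj, rfl⟩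
    rwa [rev_mem_iff hK]
  · exact fun hi => ⟨i.rev, by rwa [rev_mem_iff hK], Fin.rev_rev i⟩

theorem orderEmbOfFin_rev (hK : K.image Fin.rev = K) (hc : K.card = r) (a : Fin r) :
    K.orderEmbOfFin hc a.rev = (K.orderEmbOfFin hc a).rev := by
  have h : (fun a : Fin r => (K.orderEmbOfFin hc a.rev).rev) = K.orderEmbOfFin hc := by
    refine orderEmbOfFin_unique hc (fun a => ?_) fun a b hab => ?_
    · rw [rev_mem_iff hK]
      exact orderEmbOfFin_mem _ _ _
    · simpa using hab
  rw [← congrFun h a, Fin.rev_rev]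

theorem exists_orderEmbOfFin_eq (hc : K.card = r) {i : Fin n} (hi : i ∈ K) :
    ∃ a, K.orderEmbOfFin hc a = i := by
  have : i ∈ Set.range (K.orderEmbOfFin hc) := by simpa using hi
  exact this

theorem sum_orderEmbOfFin (hc : K.card = r) (f : Fin n → ℝ) (hf : ∀ i ∉ K, f i = 0) :
    ∑ a, f (K.orderEmbOfFin hc a) = ∑ i, f i := by
  rw [← sum_subset (subset_univ K) fun i _ hi => hf i hi]
  conv_rhs => rw [← map_orderEmbOfFin_univ K hc, sum_map]
  rfl

@[simp] theorem sub_apply (X : Matrix (Fin n) (Fin n) ℝ) (hK : K.card = r) (hL : L.card = r)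
    (a b : Fin r) : sub X K L hK hL a b = X (K.orderEmbOfFin hK a) (L.orderEmbOfFin hL b) := rfl

theorem symmetrize_sub (X : Matrix (Fin n) (Fin n) ℝ) (hK : K.card = r) (hL : L.card = r)
    (hKr : K.image Fin.rev = K) (hLr : L.image Fin.rev = L) :
    sub (symmetrize X) K L hK hL = symmetrize (sub X K L hK hL) := by
  ext a b
  simp [orderEmbOfFin_rev hKr, orderEmbOfFin_rev hLr]

/-- The permutation of `Fin r` induced by a permutation that maps `K` into `L`. -/
theorem exists_perm_orderEmbOfFin (σ : Perm (Fin n)) (hK : K.card = r) (hL : L.card = r)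
    (h : ∀ i ∈ K, σ i ∈ L) :
    ∃ s : Perm (Fin r), ∀ a, L.orderEmbOfFin hL (s a) = σ (K.orderEmbOfFin hK a) := by
  choose s hs using fun a => exists_orderEmbOfFin_eq hL (h _ (orderEmbOfFin_mem K hK a))
  have hinj : Function.Injective s := fun a b hab => by
    have := hs a
    rw [hab, hs b] at this
    exact ((K.orderEmbOfFin hK).injective (σ.injective this)).symm
  exact ⟨Equiv.ofBijective s (Finite.injective_iff_bijective.1 hinj), hs⟩

theorem sub_permMatrix_eq {σ : Perm (Fin n)} (hK : K.card = r) (hL : L.card = r)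
    {s : Perm (Fin r)} (hs : ∀ a, L.orderEmbOfFin hL (s a) = σ (K.orderEmbOfFin hK a)) :
    sub (σ.permMatrix ℝ) K L hK hL = s.permMatrix ℝ := by
  ext a b
  simp only [sub_apply, permMatrix_apply, ← hs, (L.orderEmbOfFin hL).injective.eq_iff]

end Sub

/-! ### Zero-line-sum matrices supported on a cycle -/

section Cyclic

variable {r : ℕ}

theorem finRotate_ne_self (hr : 2 ≤ r) (k : Fin r) : finRotate r k ≠ k := by
  obtain ⟨m, rfl⟩ := Nat.exists_eq_add_of_le' hr
  rw [finRotate_apply]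
  simp

theorem exists_eq_const_of_finRotate {f : Fin r → ℝ} (hf : ∀ k, f (finRotate r k) = f k) :
    ∃ c, ∀ k, f k = c := by
  cases r with
  | zero => exact ⟨0, fun k => k.elim0⟩
  | succ m =>
    refine ⟨f 0, fun k => ?_⟩
    induction k using Fin.induction with
    | zero => rfl
    | succ i ih =>
      rw [← ih, ← hf i.castSucc, finRotate_apply, Fin.coeSucc_eq_succ]

/-- A matrix with zero line sums supported in a cyclic matrix takes alternately the values `c`
and `-c` along the cycle. -/
theorem exists_alternating {X D : Matrix (Fin r) (Fin r) ℝ} (hr : 2 ≤ r) {u v : Perm (Fin r)}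
    (hX : ∀ k l : Fin r,
      X (u k) (v l) = (if l = k then 1 else 0) + (if l = finRotate r k then 1 else 0))
    (hsupp : ∀ i j, X i j = 0 → D i j = 0)
    (hrow : ∀ i, ∑ j, D i j = 0) (hcol : ∀ j, ∑ i, D i j = 0) :
    ∃ c : ℝ, ∀ k l, D (u k) (v l) =
      c * ((if l = k then 1 else 0) - (if l = finRotate r k then 1 else 0)) := by
  have h0 : ∀ k l, l ≠ k → l ≠ finRotate r k → D (u k) (v l) = 0 := fun k l h1 h2 =>
    hsupp _ _ (by rw [hX, if_neg h1, if_neg h2, add_zero])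
  -- As r ≥ 2, positions k and k + 1 differ, so each line of D has just two entries that may be
  -- nonzero, and they cancel.
  have hR : ∀ k, D (u k) (v k) + D (u k) (v (finRotate r k)) = 0 := fun k => by
    rw [← hrow (u k), ← Equiv.sum_comp v]
    exact (sum_eq_add _ _ (finRotate_ne_self hr k).symm (fun l _ hl => h0 k l hl.1 hl.2)
      (by simp) (by simp)).symm
  have hC : ∀ k, D (u k) (v (finRotate r k)) + D (u (finRotate r k)) (v (finRotate r k)) = 0 :=
    fun k => by
    rw [← hcol (v (finRotate r k)), ← Equiv.sum_comp u]
    exact (sum_eq_add _ _ (finRotate_ne_self hr k).symm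
      (fun l _ hl => h0 l _ hl.2.symm fun h => hl.1 ((finRotate r).injective h).symm)
      (by simp) (by simp)).symm
  obtain ⟨c, hc⟩ := exists_eq_const_of_finRotate (f := fun k => D (u k) (v k))
    fun k => by linarith [hR k, hC k]
  refine ⟨c, fun k l => ?_⟩
  by_cases h1 : l = k
  · subst h1
    rw [hc, if_pos rfl, if_neg (finRotate_ne_self hr l).symm, sub_zero, mul_one]
  · by_cases h2 : l = finRotate r k
    · subst h2
      simp only [finRotate_ne_self hr k, if_false, if_true]
      linarith [hR k, hc k]
    · rw [h0 k l h1 h2, if_neg h1, if_neg h2, sub_zero, mul_zero]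

/-- D and E are multiples of the same alternating matrix, so D is a multiple of E ≠ 0. Rotation
fixes D but negates E. -/
theorem IsCyclic.eq_zero_of_isCentrosymmetric {X D E : Matrix (Fin r) (Fin r) ℝ} (hr : 2 ≤ r)
    (hX : IsCyclic X)
    (hD : ∀ i j, X i j = 0 → D i j = 0) (hDrow : ∀ i, ∑ j, D i j = 0)
    (hDcol : ∀ j, ∑ i, D i j = 0) (hDc : IsCentrosymmetric D)
    (hE : ∀ i j, X i j = 0 → E i j = 0) (hErow : ∀ i, ∑ j, E i j = 0)
    (hEcol : ∀ j, ∑ i, E i j = 0) (hEc : ∀ i j, E i.rev j.rev = -E i j) (hE0 : E ≠ 0) :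
    D = 0 := by
  obtain ⟨u, v, huv⟩ := hX
  obtain ⟨c, hc⟩ := exists_alternating hr huv hD hDrow hDcol
  obtain ⟨e, he⟩ := exists_alternating hr huv hE hErow hEcol
  have hprop : ∀ i j, e * D i j = c * E i j := fun i j => by
    obtain ⟨k, rfl⟩ := u.surjective i
    obtain ⟨l, rfl⟩ := v.surjective j
    rw [hc, he]
    ring
  have he0 : e ≠ 0 := by
    rintro rfl
    refine hE0 (Matrix.ext fun i j => ?_)
    obtain ⟨k, rfl⟩ := u.surjective i
    obtain ⟨l, rfl⟩ := v.surjective j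
    simp [he]
  ext i j
  have h1 := hprop i j
  have h2 := hprop i.rev j.rev
  rw [hEc, hDc.apply_rev] at h2
  have h3 : e * D i j = 0 := by linarith
  simpa [he0] using h3

end Cyclic

/-! ### Matrices of type (b) are extreme -/

section TypeB

variable {n r : ℕ} {K L : Finset (Fin n)}

theorem two_le_of_isAntiCentrosymmetricPerm {P : Matrix (Fin r) (Fin r) ℝ} (hr : Odd r)
    (hP : IsAntiCentrosymmetricPerm P) : 2 ≤ r := by
  obtain ⟨⟨σ, rfl⟩, hanti⟩ := hP
  by_contra hlt
  obtain rfl : r = 1 := by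
    have := hr.pos
    omega
  have h := hanti 0 0 (by simp [Subsingleton.elim (σ 0) 0])
  simp [Subsingleton.elim _ (0 : Fin 1)] at h

theorem sum_row_sub {X : Matrix (Fin n) (Fin n) ℝ} (hX : X ∈ doublyStochastic ℝ (Fin n))
    (hK : K.card = r) (hL : L.card = r) (hiso : IsIsolated X K L) (a : Fin r) :
    ∑ b, sub X K L hK hL a b = 1 := by
  rw [← sum_row_of_mem_doublyStochastic hX (K.orderEmbOfFin hK a)]
  exact sum_orderEmbOfFin hL (fun j => X (K.orderEmbOfFin hK a) j)
    fun j hj => hiso.1 _ (orderEmbOfFin_mem _ _ _) j hj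

theorem sum_col_sub {X : Matrix (Fin n) (Fin n) ℝ} (hX : X ∈ doublyStochastic ℝ (Fin n))
    (hK : K.card = r) (hL : L.card = r) (hiso : IsIsolated X K L) (b : Fin r) :
    ∑ a, sub X K L hK hL a b = 1 := by
  rw [← sum_col_of_mem_doublyStochastic hX (L.orderEmbOfFin hL b)]
  exact sum_orderEmbOfFin hK (fun i => X i (L.orderEmbOfFin hL b))
    fun i hi => hiso.2 i hi _ (orderEmbOfFin_mem _ _ _)

theorem IsTypeB.symmetrize_mem_extremePoints {hn : Odd n} {Q : Matrix (Fin n) (Fin n) ℝ}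
    (hQ : IsPermutationMatrix Q) {P : Matrix (Fin r) (Fin r) ℝ} {hK : K.card = r} {hL : L.card = r}
    (h : IsTypeB hn Q P K L hK hL) : symmetrize Q ∈ (Omega n).extremePoints ℝ := by
  obtain ⟨-, hr, hanti, hcyc, ⟨-, -, hKr, hLr⟩, hiso, hsub, ⟨τ, hτ⟩, -⟩ := h
  have hr2 := two_le_of_isAntiCentrosymmetricPerm hr hanti
  obtain ⟨⟨p, rfl⟩, hanti⟩ := hanti
  obtain ⟨σ, rfl⟩ := hQ
  have hA : symmetrize (σ.permMatrix ℝ) ∈ Omega n :=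
    symmetrize_mem_Omega permMatrix_mem_doublyStochastic
  generalize symmetrize (σ.permMatrix ℝ) = A at *
  refine mem_extremePoints_Omega_of_unique_support hA fun B hB hsupp => ?_
  have hisoB : IsIsolated B K L :=
    ⟨fun i hi j hj => hsupp _ _ (hiso.1 i hi j hj), fun i hi j hj => hsupp _ _ (hiso.2 i hi j hj)⟩
  have hBsub : sub B K L hK hL - sub A K L hK hL = 0 := by
    have hp : p.permMatrix ℝ ∈ doublyStochastic ℝ (Fin r) := permMatrix_mem_doublyStochastic
    have hp' := rot_mem_doublyStochastic hp
    -- P - P^π serves as the alternating matrix negated by rotation; anti-centrosymmetry makes it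
    -- nonzero.
    refine hcyc.eq_zero_of_isCentrosymmetric (E := p.permMatrix ℝ - rot (p.permMatrix ℝ)) hr2
      (fun a b hab => ?_) (fun a => ?_) (fun b => ?_) ?_ (fun a b hab => ?_) (fun a => ?_)
      (fun b => ?_) (fun a b => ?_) (fun h0 => ?_)
    · have hA0 : sub A K L hK hL a b = 0 := by
        rw [hsub]
        simp only [Matrix.add_apply, rot_apply] at hab
        rw [symmetrize_apply, hab, zero_div]
      rw [Matrix.sub_apply, hA0, sub_zero]
      exact hsupp _ _ hA0
    · simp only [Matrix.sub_apply, sum_sub_distrib, sum_row_sub hB.1 hK hL hisoB,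
        sum_row_sub hA.1 hK hL hiso, sub_self]
    · simp only [Matrix.sub_apply, sum_sub_distrib, sum_col_sub hB.1 hK hL hisoB,
        sum_col_sub hA.1 hK hL hiso, sub_self]
    · ext a b
      simp only [rot_apply, Matrix.sub_apply, sub_apply, orderEmbOfFin_rev hKr,
        orderEmbOfFin_rev hLr, hB.2.apply_rev, hA.2.apply_rev]
    · have h1 : 0 ≤ p.permMatrix ℝ a b := hp.1 a b
      have h2 : 0 ≤ rot (p.permMatrix ℝ) a b := hp'.1 a b
      rw [Matrix.add_apply] at hab
      rw [Matrix.sub_apply]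
      linarith
    · simp only [Matrix.sub_apply, sum_sub_distrib, sum_row_of_mem_doublyStochastic hp,
        sum_row_of_mem_doublyStochastic hp', sub_self]
    · simp only [Matrix.sub_apply, sum_sub_distrib, sum_col_of_mem_doublyStochastic hp,
        sum_col_of_mem_doublyStochastic hp', sub_self]
    · simp only [Matrix.sub_apply, rot_apply, Fin.rev_rev, neg_sub]
    · have ha : p.permMatrix ℝ ⟨0, by omega⟩ (p ⟨0, by omega⟩) = 1 := by simp
      have h1 := congrFun (congrFun h0 ⟨0, by omega⟩) (p ⟨0, by omega⟩)
      rw [Matrix.sub_apply, rot_apply, hanti _ _ ha, ha] at h1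
      simp at h1
  ext i j
  by_cases hi : i ∈ K
  · by_cases hj : j ∈ L
    · obtain ⟨a, rfl⟩ := exists_orderEmbOfFin_eq hK hi
      obtain ⟨b, rfl⟩ := exists_orderEmbOfFin_eq hL hj
      exact congrFun (congrFun (sub_eq_zero.1 hBsub) a) b
    · rw [hiso.1 i hi j hj, hisoB.1 i hi j hj]
  · by_cases hj : j ∈ L
    · rw [hiso.2 i hi j hj, hisoB.2 i hi j hj]
    -- The complementary block of A has entries 0 and 1 only, so its support already determines B
    -- there.
    · obtain ⟨a, ha⟩ := exists_orderEmbOfFin_eq (card_compl_eq hK) (mem_compl.2 hi)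
      obtain ⟨b, hb⟩ := exists_orderEmbOfFin_eq (card_compl_eq hL) (mem_compl.2 hj)
      have hab := congrFun (congrFun hτ a) b
      rw [complSub, sub_apply, ha, hb, permMatrix_apply] at hab
      split_ifs at hab
      · rw [hab, eq_one_of_support_subset hA.1 hB.1 hab (hsupp i)]
      · rw [hab, hsupp i j hab]

/-- If two numbers in {0, 1} have average 0 or 1, they are equal. -/
theorem IsTypeB.complSub_eq_rot {hn : Odd n} {Q : Matrix (Fin n) (Fin n) ℝ}
    (hQ : IsPermutationMatrix Q) {P : Matrix (Fin r) (Fin r) ℝ} {hK : K.card = r} {hL : L.card = r}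
    (h : IsTypeB hn Q P K L hK hL) : complSub Q K L hK hL = rot (complSub Q K L hK hL) := by
  obtain ⟨-, -, -, -, ⟨-, -, hKr, hLr⟩, -, -, ⟨τ, hτ⟩, -⟩ := h
  obtain ⟨σ, rfl⟩ := hQ
  rw [complSub, symmetrize_sub _ _ _ (image_rev_compl hKr) (image_rev_compl hLr)] at hτ
  rw [complSub]
  ext a b
  have hab := congrFun (congrFun hτ a) b
  rw [symmetrize_apply] at hab
  rw [rot_apply]
  simp only [sub_apply, permMatrix_apply] at hab ⊢
  split_ifs at hab ⊢ <;> first | rfl | norm_num at hab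

end TypeB

/-! ### Components of the multigraph of Q + Q^π under rotation -/

section Walk

variable {n : ℕ} (σ : Perm (Fin n))

/-- The permutation of the rows that follows an edge of the permutation matrix of `σ` and then an
edge of its rotation; its cycles are the components of the bipartite multigraph of `Q + Q^π`. -/
def walk : Perm (Fin n) := (rotPerm σ)⁻¹ * σ

theorem rotPerm_walk (i : Fin n) : rotPerm σ (walk σ i) = σ i := by
  simp [walk]

theorem walk_eq_self_iff {i : Fin n} : walk σ i = i ↔ rotPerm σ i = σ i := by
  rw [← rotPerm_walk σ i, (rotPerm σ).injective.eq_iff, eq_comm]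

theorem rev_apply (i : Fin n) : (σ i).rev = rotPerm σ i.rev := by simp

/-- Rotation swaps the edges of Q with those of Q^π, so it turns a step of the walk into a step
backwards. -/
theorem semiconj_walk : SemiconjBy Fin.revPerm (walk σ) (walk σ)⁻¹ := by
  ext i : 1
  simp only [Perm.mul_apply, Fin.revPerm_apply]
  rw [Perm.eq_inv_iff_eq, ← (rotPerm σ).injective.eq_iff, rotPerm_walk, ← rev_apply,
    ← rotPerm_walk σ i, rotPerm_apply, Fin.rev_rev]

theorem rev_zpow_walk (k : ℤ) (i : Fin n) :
    ((walk σ ^ k) i).rev = (walk σ ^ (-k)) i.rev := by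
  have h := (semiconj_walk σ).zpow_right k
  rw [inv_zpow, ← zpow_neg] at h
  exact congrArg (fun f : Perm (Fin n) => f i) h

variable {σ}

theorem sameCycle_walk_rev {i j : Fin n} (h : (walk σ).SameCycle i j) :
    (walk σ).SameCycle i.rev j.rev := by
  obtain ⟨k, rfl⟩ := h
  exact ⟨-k, (rev_zpow_walk σ k i).symm⟩

theorem sameCycle_walk_rev_iff {i j : Fin n} :
    (walk σ).SameCycle i.rev j ↔ (walk σ).SameCycle i j.rev :=
  ⟨fun h => by simpa using sameCycle_walk_rev h, fun h => by simpa using sameCycle_walk_rev h⟩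

/-- Reversal pairs off all elements of K other than the centre. -/
theorem odd_card_iff (hn : Odd n) {K : Finset (Fin n)} (hK : K.image Fin.rev = K) :
    Odd K.card ↔ centre hn ∈ K := by
  have h : Even (K.erase (centre hn)).card := by
    rw [← ZMod.natCast_eq_zero_iff_even, card_eq_sum_ones, Nat.cast_sum]
    refine sum_involution (fun i _ => i.rev) (fun i _ => by decide) (fun i hi _ => ?_)
      (fun i hi => ?_) (fun i _ => Fin.rev_rev i)
    · rw [Ne, rev_eq_self_iff hn]
      exact ne_of_mem_erase hi
    · rw [mem_erase] at hi ⊢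
      refine ⟨fun h => hi.1 ?_, (rev_mem_iff hK).2 hi.2⟩
      rw [← Fin.rev_rev i, h, rev_centre]
  constructor
  · intro hodd
    by_contra hc
    rw [erase_eq_of_notMem hc] at h
    exact Nat.not_even_iff_odd.2 hodd h
  · intro hc
    rw [← card_erase_add_one hc]
    exact h.add_one

variable (σ) in
/-- The rows of the component that contains the central row. -/
def centralRows (hn : Odd n) : Finset (Fin n) := by
  classical exact univ.filter fun i => (walk σ).SameCycle (centre hn) i

variable (σ) in
/-- The columns of the component that contains the central row. -/
def centralCols (hn : Odd n) : Finset (Fin n) := (centralRows σ hn).map σ.toEmbedding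

theorem mem_centralRows {hn : Odd n} {i : Fin n} :
    i ∈ centralRows σ hn ↔ (walk σ).SameCycle (centre hn) i := by
  simp [centralRows]

theorem apply_mem_centralCols {hn : Odd n} {i : Fin n} :
    σ i ∈ centralCols σ hn ↔ i ∈ centralRows σ hn := by
  simp [centralCols]

theorem rotPerm_apply_mem_centralCols {hn : Odd n} {i : Fin n} :
    rotPerm σ i ∈ centralCols σ hn ↔ i ∈ centralRows σ hn := by
  obtain ⟨j, rfl⟩ := (walk σ).surjective i
  rw [rotPerm_walk, apply_mem_centralCols, mem_centralRows, mem_centralRows,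
    Perm.sameCycle_apply_right]

theorem rev_mem_centralRows {hn : Odd n} {i : Fin n} :
    i.rev ∈ centralRows σ hn ↔ i ∈ centralRows σ hn := by
  rw [mem_centralRows, mem_centralRows, ← sameCycle_walk_rev_iff, rev_centre]

theorem image_rev_of_mem_iff {K : Finset (Fin n)} (h : ∀ i, i.rev ∈ K ↔ i ∈ K) :
    K.image Fin.rev = K := by
  ext i
  rw [mem_image]
  exact ⟨fun ⟨j, hj, hji⟩ => hji ▸ (h j).2 hj, fun hi => ⟨i.rev, (h i).2 hi, Fin.rev_rev i⟩⟩

theorem image_rev_centralRows (hn : Odd n) :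
    (centralRows σ hn).image Fin.rev = centralRows σ hn :=
  image_rev_of_mem_iff fun _ => rev_mem_centralRows

theorem image_rev_centralCols (hn : Odd n) :
    (centralCols σ hn).image Fin.rev = centralCols σ hn := by
  refine image_rev_of_mem_iff fun j => ?_
  obtain ⟨i, rfl⟩ := σ.surjective j
  rw [rev_apply, rotPerm_apply_mem_centralCols, rev_mem_centralRows, apply_mem_centralCols]

theorem card_centralCols (hn : Odd n) : (centralCols σ hn).card = (centralRows σ hn).card :=
  card_map _

theorem centre_mem_centralRows (hn : Odd n) : centre hn ∈ centralRows σ hn :=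
  mem_centralRows.2 (Perm.SameCycle.refl _ _)

theorem odd_card_centralRows (hn : Odd n) : Odd (centralRows σ hn).card :=
  (odd_card_iff hn (image_rev_centralRows hn)).2 (centre_mem_centralRows hn)

theorem centre_mem_centralCols (hn : Odd n) : centre hn ∈ centralCols σ hn := by
  rw [← odd_card_iff hn (image_rev_centralCols hn), card_centralCols]
  exact odd_card_centralRows hn

/-- The component of the central row is the only one that is invariant under rotation. -/
theorem not_sameCycle_rev (hn : Odd n) {i : Fin n} (hi : i ∉ centralRows σ hn) :
    ¬ (walk σ).SameCycle i i.rev := by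
  rintro ⟨k, hk⟩
  obtain ⟨j, rfl | rfl⟩ := Int.even_or_odd' k
  -- Halfway along an even walk from i to its mirror lies a row fixed by reversal, hence the central
  -- row.
  · have h : ((walk σ ^ j) i).rev = (walk σ ^ j) i := by
      rw [rev_zpow_walk, ← hk, ← Perm.mul_apply, ← zpow_add]
      congr 2
      ring
    rw [rev_eq_self_iff hn] at h
    exact hi (mem_centralRows.2 (h ▸ Perm.SameCycle.symm ⟨j, rfl⟩))
  -- For an odd walk the midpoint is a column instead, hence the central one, which lies in the
  -- central component.
  · have h : (σ ((walk σ ^ j) i)).rev = σ ((walk σ ^ j) i) := by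
      rw [rev_apply, rev_zpow_walk, ← hk, ← Perm.mul_apply (walk σ ^ _), ← zpow_add,
        ← rotPerm_walk σ, ← Perm.mul_apply (walk σ), ← zpow_one_add]
      congr 3
      ring
    rw [rev_eq_self_iff hn] at h
    have hc := centre_mem_centralCols (σ := σ) hn
    rw [← h, apply_mem_centralCols, mem_centralRows] at hc
    exact hi (mem_centralRows.2 (hc.trans (Perm.SameCycle.symm ⟨j, rfl⟩)))

end Walk

/-! ### Perturbing along a non-central component -/

section Perturb

variable {n : ℕ} {σ : Perm (Fin n)}

theorem eq_zero_of_mem_extremePoints {E : Type*} [AddCommGroup E] [Module ℝ E] {S : Set E}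
    {x e : E} (hx : x ∈ S.extremePoints ℝ) (h1 : x + e ∈ S) (h2 : x - e ∈ S) : e = 0 := by
  have h := (mem_extremePoints_iff_left.1 hx).2 _ h1 _ h2
    ⟨1 / 2, 1 / 2, by norm_num, by norm_num, by norm_num, by module⟩
  simpa using h

/-- The matrix `½ W (Q - Q^π)` with `W` the diagonal matrix of weights `w`. -/
noncomputable def perturbation (σ : Perm (Fin n)) (w : Fin n → ℝ) : Matrix (Fin n) (Fin n) ℝ :=
  Matrix.of fun i j => w i * (σ.permMatrix ℝ i j - (rotPerm σ).permMatrix ℝ i j) / 2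

/-- The entries are ((1 + w)q + (1 - w)q')/2, with q from Q and q' from Q^π. The bound on w gives
nonnegativity, constancy along the walk the column sums, and oddness under reversal centrosymmetry.
-/
theorem symmetrize_add_perturbation_mem_Omega {w : Fin n → ℝ} (hw1 : ∀ i, |w i| ≤ 1)
    (hwalk : ∀ i, w (walk σ i) = w i) (hrev : ∀ i, w i.rev = -w i) :
    symmetrize (σ.permMatrix ℝ) + perturbation σ w ∈ Omega n := by
  have hA : symmetrize (σ.permMatrix ℝ) ∈ Omega n :=
    symmetrize_mem_Omega permMatrix_mem_doublyStochastic
  have hrot : ∀ i j : Fin n, σ.permMatrix ℝ i.rev j.rev = (rotPerm σ).permMatrix ℝ i j :=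
    permMatrix_rev_rev σ
  have hrot' : ∀ i j : Fin n, (rotPerm σ).permMatrix ℝ i.rev j.rev = σ.permMatrix ℝ i j :=
    fun i j => by rw [← hrot, Fin.rev_rev, Fin.rev_rev]
  refine ⟨mem_doublyStochastic_iff_sum.2 ⟨fun i j => ?_, fun i => ?_, fun j => ?_⟩, ?_⟩
  · have h1 : 0 ≤ σ.permMatrix ℝ i j := permMatrix_mem_doublyStochastic.1 i j
    have h2 : 0 ≤ (rotPerm σ).permMatrix ℝ i j := permMatrix_mem_doublyStochastic.1 i j
    obtain ⟨h3, h4⟩ := abs_le.1 (hw1 i)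
    rw [Matrix.add_apply, symmetrize_apply, hrot, perturbation, Matrix.of_apply]
    nlinarith [mul_nonneg h1 (neg_le_iff_add_nonneg'.1 h3), mul_nonneg h2 (sub_nonneg.2 h4)]
  · simp only [Matrix.add_apply, sum_add_distrib, sum_row_of_mem_doublyStochastic hA.1,
      perturbation, Matrix.of_apply, ← sum_div, ← mul_sum, sum_sub_distrib,
      sum_row_of_mem_doublyStochastic (permMatrix_mem_doublyStochastic (σ := σ)),
      sum_row_of_mem_doublyStochastic (permMatrix_mem_doublyStochastic (σ := rotPerm σ))]
    simp
  · simp only [Matrix.add_apply, sum_add_distrib, sum_col_of_mem_doublyStochastic hA.1,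
      perturbation, Matrix.of_apply, ← sum_div, permMatrix_apply, mul_sub, sum_sub_distrib,
      mul_ite, mul_one, mul_zero]
    obtain ⟨i, rfl⟩ := σ.surjective j
    have h1 : ∀ k, σ k = σ i ↔ k = i := fun k => σ.injective.eq_iff
    have h2 : ∀ k, rotPerm σ k = σ i ↔ k = walk σ i := fun k => by
      rw [← rotPerm_walk σ, (rotPerm σ).injective.eq_iff]
    simp only [h1, h2, sum_ite_eq', mem_univ, if_true, hwalk]
    simp
  · ext i j
    rw [rot_apply, Matrix.add_apply, Matrix.add_apply, hA.2.apply_rev, perturbation,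
      Matrix.of_apply, Matrix.of_apply, hrot, hrot', hrev]
    ring

theorem walk_eq_self_of_mem_extremePoints (hn : Odd n)
    (hA : symmetrize (σ.permMatrix ℝ) ∈ (Omega n).extremePoints ℝ) {i : Fin n}
    (hi : i ∉ centralRows σ hn) : walk σ i = i := by
  classical
  by_contra hne
  let χ : Fin n → ℝ := fun j => if (walk σ).SameCycle i j then 1 else 0
  -- The weight is 1 on the component of i, -1 on its mirror image and 0 elsewhere. Both signs of
  -- the perturbation stay in Ω_n^π, yet its entry at (i, σ i) is ½.
  let w : Fin n → ℝ := fun j => χ j - χ j.rev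
  have hχ0 : ∀ j, 0 ≤ χ j := fun j => by dsimp only [χ]; split_ifs <;> norm_num
  have hχ1 : ∀ j, χ j ≤ 1 := fun j => by dsimp only [χ]; split_ifs <;> norm_num
  have hχrev : ∀ j, χ (walk σ j).rev = χ j.rev := fun j => by
    simp only [χ, ← sameCycle_walk_rev_iff, Perm.sameCycle_apply_right]
  have hw1 : ∀ j, |w j| ≤ 1 := fun j =>
    abs_le.2 ⟨by linarith [hχ0 j, hχ1 j.rev], by linarith [hχ1 j, hχ0 j.rev]⟩
  have hwalk : ∀ j, w (walk σ j) = w j := fun j => by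
    simp only [w, hχrev]
    simp only [χ, Perm.sameCycle_apply_right]
  have hrev : ∀ j, w j.rev = -w j := fun j => by simp [w]
  have h1 := symmetrize_add_perturbation_mem_Omega hw1 hwalk hrev
  have h2 := symmetrize_add_perturbation_mem_Omega (σ := σ) (w := fun j => -w j)
    (fun j => by rw [abs_neg]; exact hw1 j) (fun j => by rw [hwalk]) (fun j => by rw [hrev])
  have hneg : perturbation σ (fun j => -w j) = -perturbation σ w := by
    ext i j
    simp only [perturbation, Matrix.of_apply, Matrix.neg_apply]
    ring
  rw [hneg, ← sub_eq_add_neg] at h2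
  have h := congrFun (congrFun (eq_zero_of_mem_extremePoints hA h1 h2) i) (σ i)
  rw [walk_eq_self_iff] at hne
  have hwi : w i = 1 := by
    simp only [w, χ, if_pos (Perm.SameCycle.refl _ _), if_neg (not_sameCycle_rev hn hi), sub_zero]
  simp only [perturbation, Matrix.of_apply, permMatrix_apply, hwi, if_neg hne, if_true] at h
  norm_num at h

end Perturb

/-! ### Extreme points are of type (a) or (b) -/

section Classification

variable {n : ℕ} {σ : Perm (Fin n)}

theorem isCyclic_of_sameCycle_walk {r : ℕ} (hr : 2 ≤ r) {s : Perm (Fin r)}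
    (hs : ∀ a b, (walk s).SameCycle a b) :
    IsCyclic (s.permMatrix ℝ + rot (s.permMatrix ℝ)) := by
  have hne : ∀ a, walk s a ≠ a := fun a ha => by
    have : Nontrivial (Fin r) := Fin.nontrivial_iff_two_le.2 hr
    obtain ⟨b, hb⟩ := exists_ne a
    obtain ⟨k, hk⟩ := hs a b
    exact hb (hk ▸ Perm.zpow_apply_eq_self_of_apply_eq_self ha k)
  have hcyc : (walk s).IsCycle := ⟨⟨0, by omega⟩, hne _, fun b _ => hs _ b⟩
  have hsupp : (walk s).support = univ := by
    ext a
    simp [hne]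
  have hconj : IsConj (finRotate r) (walk s) := by
    rw [Perm.isConj_iff_cycleType_eq, cycleType_finRotate_of_le hr, hcyc.cycleType, hsupp]
    simp
  obtain ⟨u, hu⟩ := isConj_iff.1 hconj
  have hu' : ∀ k, u (finRotate r k) = walk s (u k) := fun k => by
    rw [← hu]
    simp
  -- With v k = `rotPerm s (u k)`, row u k meets column v k by an edge of the rotated matrix and v
  -- (k + 1) by an edge of s.
  refine ⟨u, u.trans (rotPerm s), fun k l => ?_⟩
  have h1 : s (u k) = rotPerm s (u l) ↔ l = finRotate r k := by
    rw [← rotPerm_walk, ← hu', (rotPerm s).injective.eq_iff, u.injective.eq_iff, eq_comm]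
  have h2 : rotPerm s (u k) = rotPerm s (u l) ↔ l = k := by
    rw [(rotPerm s).injective.eq_iff, u.injective.eq_iff, eq_comm]
  rw [rot_permMatrix, Matrix.add_apply, permMatrix_apply, permMatrix_apply, Equiv.trans_apply,
    add_comm]
  simp only [h1, h2]

theorem isTypeA_of_mem_extremePoints (hn : Odd n)
    (hA : symmetrize (σ.permMatrix ℝ) ∈ (Omega n).extremePoints ℝ)
    (hc : σ (centre hn) = centre hn) : IsTypeA hn (σ.permMatrix ℝ) := by
  have hwc : walk σ (centre hn) = centre hn := by
    rw [walk_eq_self_iff, rotPerm_apply, rev_centre, hc, rev_centre]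
  refine ⟨by simp [hc], ?_⟩
  rw [IsCentrosymmetric, rot_permMatrix]
  congr 1
  ext i : 1
  rw [← walk_eq_self_iff]
  by_cases hi : i ∈ centralRows σ hn
  · obtain ⟨k, hk⟩ := mem_centralRows.1 hi
    rw [Perm.zpow_apply_eq_self_of_apply_eq_self hwc] at hk
    rw [← hk, hwc]
  · exact walk_eq_self_of_mem_extremePoints hn hA hi

theorem isTypeB_of_mem_extremePoints (hn : Odd n)
    (hA : symmetrize (σ.permMatrix ℝ) ∈ (Omega n).extremePoints ℝ)
    (hc : σ (centre hn) ≠ centre hn) :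
    IsTypeB hn (σ.permMatrix ℝ)
      (sub (σ.permMatrix ℝ) (centralRows σ hn) (centralCols σ hn) rfl (card_centralCols hn))
      (centralRows σ hn) (centralCols σ hn) rfl (card_centralCols hn) := by
  have hKr := image_rev_centralRows (σ := σ) hn
  have hLr := image_rev_centralCols (σ := σ) hn
  have hwc : walk σ (centre hn) ≠ centre hn := by
    rw [Ne, walk_eq_self_iff, rotPerm_apply, rev_centre, rev_eq_self_iff hn]
    exact hc
  have hr : 2 ≤ (centralRows σ hn).card := by
    refine one_lt_card.2 ⟨_, ?_, _, centre_mem_centralRows hn, hwc⟩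
    rw [mem_centralRows, Perm.sameCycle_apply_right]
  obtain ⟨s, hs⟩ := exists_perm_orderEmbOfFin σ (K := centralRows σ hn) (L := centralCols σ hn) rfl
    (card_centralCols hn) fun i hi => apply_mem_centralCols.2 hi
  have hsub := sub_permMatrix_eq rfl (card_centralCols hn) hs
  have hrot : ∀ a, (centralCols σ hn).orderEmbOfFin (card_centralCols hn) (rotPerm s a) =
      rotPerm σ ((centralRows σ hn).orderEmbOfFin rfl a) := fun a => by
    rw [rotPerm_apply, orderEmbOfFin_rev hLr, hs, orderEmbOfFin_rev hKr, rotPerm_apply]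
  have hwalk : ∀ a, (centralRows σ hn).orderEmbOfFin rfl (walk s a) =
      walk σ ((centralRows σ hn).orderEmbOfFin rfl a) := fun a => by
    apply (rotPerm σ).injective
    rw [← hrot, rotPerm_walk, rotPerm_walk, hs]
  have hpow : ∀ (k : ℕ) a, (centralRows σ hn).orderEmbOfFin rfl ((walk s ^ k) a) =
      (walk σ ^ k) ((centralRows σ hn).orderEmbOfFin rfl a) := fun k a => by
    induction k with
    | zero => rfl
    | succ k ih => rw [pow_succ', pow_succ', Perm.mul_apply, Perm.mul_apply, hwalk, ih]
  have hcycle : ∀ a b, (walk s).SameCycle a b := fun a b => by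
    have ha := mem_centralRows.1 (orderEmbOfFin_mem (centralRows σ hn) rfl a)
    have hb := mem_centralRows.1 (orderEmbOfFin_mem (centralRows σ hn) rfl b)
    obtain ⟨k, -, hk⟩ := (ha.symm.trans hb).exists_pow_eq'
    rw [← hpow] at hk
    exact ⟨k, ((centralRows σ hn).orderEmbOfFin rfl).injective hk⟩
  -- A double edge would be a fixed point of `walk s`; as there is only one cycle, it would be the
  -- central row, which moves.
  have hne : ∀ a, rotPerm s a ≠ s a := fun a ha => by
    obtain ⟨b, hb⟩ := exists_orderEmbOfFin_eq rfl (centre_mem_centralRows (σ := σ) hn)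
    obtain ⟨k, rfl⟩ := hcycle a b
    have hfix := (walk_eq_self_iff s).2 ha
    rw [Perm.zpow_apply_eq_self_of_apply_eq_self hfix] at hb
    exact hwc (by rw [← hb, ← hwalk, hfix])
  have hiso : IsIsolated (symmetrize (σ.permMatrix ℝ)) (centralRows σ hn) (centralCols σ hn) := by
    have key : ∀ i j, (i ∈ centralRows σ hn ↔ j ∉ centralCols σ hn) →
        symmetrize (σ.permMatrix ℝ) i j = 0 := fun i j hij => by
      have h1 : σ i ≠ j := by
        rintro rfl
        rw [apply_mem_centralCols] at hij
        tauto
      have h2 : rotPerm σ i ≠ j := by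
        rintro rfl
        rw [rotPerm_apply_mem_centralCols] at hij
        tauto
      rw [symmetrize_apply, permMatrix_rev_rev, permMatrix_apply, permMatrix_apply,
        if_neg h1, if_neg h2, add_zero, zero_div]
    exact ⟨fun i hi j hj => key i j (iff_of_true hi hj),
      fun i hi j hj => key i j (iff_of_false hi (not_not.2 hj))⟩
  refine ⟨by simp [hc], odd_card_centralRows hn, ⟨⟨s, hsub⟩, fun a b hab => ?_⟩, ?_,
    ⟨centre_mem_centralRows hn, centre_mem_centralCols hn, hKr, hLr⟩, hiso,
    symmetrize_sub _ _ _ hKr hLr, ?_, ?_⟩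
  · rw [hsub] at hab ⊢
    rw [permMatrix_rev_rev]
    rw [permMatrix_apply] at hab ⊢
    obtain rfl : s a = b := by simpa using hab
    exact if_neg (hne a)
  · rw [hsub]
    exact isCyclic_of_sameCycle_walk hr hcycle
  · obtain ⟨t, ht⟩ := exists_perm_orderEmbOfFin σ
      (card_compl_eq (K := centralRows σ hn) rfl)
      (card_compl_eq (K := centralCols σ hn) (card_centralCols hn))
      fun i hi => mem_compl.2 fun h => mem_compl.1 hi (apply_mem_centralCols.1 h)
    refine ⟨t, ?_⟩
    rw [← sub_permMatrix_eq _ _ ht]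
    ext a b
    have hi := mem_compl.1 (orderEmbOfFin_mem (centralRows σ hn)ᶜ (card_compl_eq rfl) a)
    have hfix := (walk_eq_self_iff σ).1 (walk_eq_self_of_mem_extremePoints hn hA hi)
    rw [complSub, sub_apply, sub_apply, symmetrize_apply, permMatrix_rev_rev,
      permMatrix_apply, permMatrix_apply, hfix, add_self_div_two]
  · rw [complSub, symmetrize_sub _ _ _ (image_rev_compl hKr) (image_rev_compl hLr)]
    exact isCentrosymmetric_symmetrize _

end Classification

end Centrosym

/-- The second conjunct records the consequences introduced by "thus" in (a) and (b). -/
theorem mainTheorem3 (n : ℕ) (hn : Odd n) (h3 : 3 ≤ n) :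
    (Centrosym.Omega n).extremePoints ℝ =
      {A : Matrix (Fin n) (Fin n) ℝ | ∃ Q : Matrix (Fin n) (Fin n) ℝ,
        Centrosym.IsPermutationMatrix Q ∧ A = Centrosym.symmetrize Q ∧
        (Centrosym.IsTypeA hn Q ∨
          ∃ (r : ℕ) (P : Matrix (Fin r) (Fin r) ℝ) (K L : Finset (Fin n))
            (hK : K.card = r) (hL : L.card = r), Centrosym.IsTypeB hn Q P K L hK hL)} ∧
    ∀ Q : Matrix (Fin n) (Fin n) ℝ, Centrosym.IsPermutationMatrix Q →
      (Centrosym.IsTypeA hn Q →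
        Q = Centrosym.rot Q ∧ Centrosym.IsPermutationMatrix (Centrosym.symmetrize Q) ∧
          Centrosym.IsCentrosymmetric (Centrosym.symmetrize Q)) ∧
      (∀ (r : ℕ) (P : Matrix (Fin r) (Fin r) ℝ) (K L : Finset (Fin n))
        (hK : K.card = r) (hL : L.card = r), Centrosym.IsTypeB hn Q P K L hK hL →
          Centrosym.complSub Q K L hK hL =
            Centrosym.rot (Centrosym.complSub Q K L hK hL)) := by
  refine ⟨Set.Subset.antisymm (fun A hA => ?_) ?_, fun Q hQ => ⟨fun hQA => ?_, ?_⟩⟩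
  · obtain ⟨σ, rfl⟩ := Centrosym.exists_eq_symmetrize_of_mem_extremePoints hA
    refine ⟨_, ⟨σ, rfl⟩, rfl, ?_⟩
    by_cases hc : σ (Centrosym.centre hn) = Centrosym.centre hn
    · exact Or.inl (Centrosym.isTypeA_of_mem_extremePoints hn hA hc)
    · exact Or.inr ⟨_, _, _, _, _, _, Centrosym.isTypeB_of_mem_extremePoints hn hA hc⟩
  · rintro A ⟨Q, hQ, rfl, hQA | ⟨r, P, K, L, hK, hL, hQB⟩⟩
    · rw [hQA.2.symmetrize_eq]
      exact Centrosym.isPermutationMatrix_mem_extremePoints hQ hQA.2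
    · exact hQB.symmetrize_mem_extremePoints hQ
  · rw [hQA.2.symmetrize_eq]
    exact ⟨hQA.2.symm, hQ, hQA.2⟩
  · exact fun r P K L hK hL hQB => hQB.complSub_eq_rot hQ
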